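/- **Setting.** Let $\mathbb k$ be a commutative unital ring, $A$ an associative unital $\mathbb k$-algebra, and $\Omega_d^\bullet=\bigoplus_{m\ge 0}\Omega_d^m$ an exterior algebra over $A$: a graded associative unital $\mathbb k$-algebra (product $\wedge$) with $\Omega_d^0=A$, equipped with a $\mathbb k$-linear $d$ of degree $1$ with $d^2=0$ and $d(\omega\wedge\eta)=d\omega\wedge\eta+(-1)^{\deg\omega}\omega\wedge d\eta$, and generated as an algebra by $A$ and $dA$. For a left $A$-module $E$ write $\Omega_d^mE=\Omega_d^m\otimes_AE$. *First jets.* $J_d^1E=J^1_dA\otimes_AE$, where $J_d^1A=(A\otimes A)/\{\sum_i a_i\otimes b_i:\ \sum_i a_ib_i=0,\ \sum_i a_i\,db_i=0\}$, with prolongation $j^1_{d,E}(e)=[1\otimes1]\otimes e$, projection $\pi^{1,0}_{d,E}([a\otimes b]\otimes e)=abe$ and inclusion $\iota^1_{d,E}:\Omega^1_dE\to J^1_dE$, $da\otimes e\mapsto j^1_{d,E}(ae)-a\,j^1_{d,E}(e)$. *Holonomic jets.* $J_d^{-1}E=0$, $J_d^0E=E$, and for $n\ge2$ the module $J_d^nE$,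 with inclusion $l^{1,n-1}:J_d^nE\hookrightarrow J_d^1J_d^{n-1}E$, is the kernel of $$J_d^1J_d^{n-1}E\xrightarrow{J_d^1(l^{1,n-2})}J_d^1J_d^1J_d^{n-2}E\xrightarrow{\widetilde{\mathrm D}}(\Omega_d^1\ltimes\Omega_d^2)J_d^{n-2}E,$$ where $l^{1,0}=\mathrm{id}$, $\widetilde{\mathrm D}([a\otimes b]\otimes[c\otimes e])=a\,d(bc)\otimes e+da\wedge d(bc)\otimes e$ and $\Omega_d^1\ltimes\Omega_d^2$ is $\Omega_d^1\oplus\Omega_d^2$ with left action $\lambda(\alpha+\beta)=\lambda\alpha+d\lambda\wedge\alpha+\lambda\beta$. The projection is $\pi^{n,n-1}_{d,E}=\pi^{1,0}\circ l^{1,n-1}$ for $n\ge 1$ (and $\pi^{0,-1}_{d,E}=0$); the prolongation $j^n_{d,E}:E\to J_d^nE$ is given by $j^0_{d,E}=\mathrm{id}$, $l^{1,n-1}\circ j_{d,E}^n=j^1\circ j_{d,E}^{n-1}$. *Symmetric forms.* $S_d^0E=E$, $S_d^1E=\Omega_d^1E$, and for $n\ge2$, $\iota_\wedge:S_d^nE\hookrightarrow\Omega_d^1S_d^{n-1}E$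 is the kernel of $\Omega_d^1S_d^{n-1}E\to\Omega_d^1\Omega_d^1S_d^{n-2}E\xrightarrow{\wedge}\Omega_d^2S_d^{n-2}E$. The map $\iota^n_{d,E}:S_d^nE\to J_d^nE$ is given by $\iota^0_{d,E}=\mathrm{id}$, $l^{1,n-1}\circ\iota_{d,E}^n=\iota^1\circ\Omega_d^1(\iota_{d,E}^{n-1})\circ\iota_\wedge$ (with $\iota_\wedge=\mathrm{id}$ on $S_d^1E$). The $n$-jet sequence at $E$ is $0\to S_d^nE\xrightarrow{\iota^n_{d,E}}J_d^nE\xrightarrow{\pi^{n,n-1}_{d,E}}J_d^{n-1}E\to0$. *Operators, symbols, quantizations, connections.* $\mathrm{Diff}_d^n(E,F)$ is the $\mathbb k$-module of maps $\Delta=\widetilde\Delta\circ j^n_{d,E}:E\to F$ with $\widetilde\Delta:J_d^nE\to F$ left $A$-linear (a lift of $\Delta$), with $\mathrm{Diff}_d^{-1}(E,F)=0$; $\mathrm{Symb}_d^n(E,F)=\mathrm{Diff}_d^n(E,F)/\mathrm{Diff}_d^{n-1}(E,F)$, with quotient map $\varsigma^n$. Both are functors of $F$, from left $A$-modules to $\mathbb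 k$-modules. A natural $n$-quantization for $E$ is a natural transformation $q^n:\mathrm{Symb}_d^n(E,-)\to\mathrm{Diff}_d^n(E,-)$ with $\varsigma^n\circ q^n=\mathrm{id}$. An $n$-connection on $E$ is a left $A$-linear map $C^n:J_d^{n-1}E\to J_d^nE$ with $\pi^{n,n-1}_{d,E}\circ C^n=\mathrm{id}$. **Theorem.** Let $n\ge0$ and let $E$ be a left $A$-module such that $J_d^nE$ equals its submodule of elemental jets $\check J_d^nE=A\,j^n_{d,E}(E)$ and such that the $n$-jet sequence at $E$ is split exact. Then there is a bijection between the $n$-connections on $E$ and the natural $n$-quantizations for $E$ which sends $C^n$ to the $q^n$ given, for every left $A$-module $F$ and every $\sigma\in\mathrm{Symb}_d^n(E,F)$, by $$q^n(\sigma)=r^n_{d,E,F}(\sigma)\circ\nabla^n,\qquad \nabla^n=\widetilde\nabla^n\circ j^n_{d,E}.$$ Here $\widetilde\nabla^n:J_d^nE\to S_d^nE$ is the left splitting associated to $C^n$, determined by $\iota^n_{d,E}\circ\widetilde\nabla^n=\mathrm{id}-C^n\circ\pi^{n,n-1}_{d,E}$, and $r^n_{d,E,F}:\mathrm{Symb}_d^n(E,F)\to{}_A\mathrm{Hom}(S_d^nE,F)$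 is the (well-defined) restriction symbol, sending the class of $\Delta$ to $\widetilde\Delta\circ\iota^n_{d,E}$ for any lift $\widetilde\Delta$ of $\Delta$. -/

import Mathlib

open CategoryTheory
open scoped TensorProduct

universe w v u

/-- An exterior algebra over an associative unital `k`-algebra `A`: a graded associative unital
`k`-algebra `Ω = ⨁ Ωᵐ` with `Ω⁰ = A`, with a `k`-linear differential `d` of degree `1`, of square
zero, satisfying the graded Leibniz rule, and such that `Ω` is generated as an algebra by `A` and
`dA`.  No commutativity of any kind is required.  The product of `Ω` is the wedge product. -/
structure ExteriorCalculus (k : Type w) [CommRing k] (A : Type v) [Ring A] [Algebra k A] where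
  /-- the total algebra -/
  Ω : Type u
  [ring : Ring Ω]
  [algebra : Algebra k Ω]
  /-- the homogeneous components `Ωᵐ` -/
  grading : ℕ → Submodule k Ω
  [graded : GradedAlgebra grading]
  /-- the identification of `A` with `Ω⁰` -/
  ofA : A →ₐ[k] Ω
  ofA_injective : Function.Injective ofA
  range_ofA : LinearMap.range ofA.toLinearMap = grading 0
  /-- the exterior differential -/
  d : Ω →ₗ[k] Ω
  d_mem : ∀ {m : ℕ} {ω : Ω}, ω ∈ grading m → d ω ∈ grading (m + 1)
  d_d : ∀ ω : Ω, d (d ω) = 0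
  leibniz : ∀ {m : ℕ} {ω : Ω}, ω ∈ grading m → ∀ η : Ω,
    d (ω * η) = d ω * η + (-1) ^ m * (ω * d η)
  generated : Algebra.adjoin k (Set.range ofA ∪ Set.range fun a => d (ofA a)) = ⊤

namespace ExteriorCalculus

attribute [instance] ExteriorCalculus.ring ExteriorCalculus.algebra ExteriorCalculus.graded

noncomputable section

variable {k : Type w} [CommRing k] {A : Type v} [Ring A] [Algebra k A]
variable (X : ExteriorCalculus.{w, v, u} k A)

lemma ofA_mem (a : A) : X.ofA a ∈ X.grading 0 := by
  rw [← X.range_ofA]; exact ⟨a, rfl⟩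

lemma left_mem (a : A) {m : ℕ} {ω : X.Ω} (h : ω ∈ X.grading m) : X.ofA a * ω ∈ X.grading m := by
  simpa using SetLike.mul_mem_graded (X.ofA_mem a) h

lemma right_mem (a : A) {m : ℕ} {ω : X.Ω} (h : ω ∈ X.grading m) : ω * X.ofA a ∈ X.grading m := by
  simpa using SetLike.mul_mem_graded h (X.ofA_mem a)

/-! ### The bimodules of forms -/

/-- The module `Ωᵐ` of forms of degree `m`. -/
def Form (m : ℕ) : Type u := X.grading m

instance (m : ℕ) : AddCommGroup (X.Form m) := inferInstanceAs (AddCommGroup (X.grading m))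

/-- The left `A`-module structure of `Ωᵐ`. -/
instance (m : ℕ) : Module A (X.Form m) where
  smul a ω := ⟨X.ofA a * ω.1, X.left_mem a ω.2⟩
  one_smul ω := Subtype.ext (show X.ofA 1 * ω.1 = ω.1 by simp)
  mul_smul a b ω := Subtype.ext
    (show X.ofA (a * b) * ω.1 = X.ofA a * (X.ofA b * ω.1) by simp [mul_assoc])
  smul_zero a := Subtype.ext (show X.ofA a * (0 : X.Ω) = 0 by simp)
  smul_add a ω η := Subtype.ext
    (show X.ofA a * (ω.1 + η.1) = X.ofA a * ω.1 + X.ofA a * η.1 from mul_add _ _ _)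
  add_smul a b ω := Subtype.ext
    (show X.ofA (a + b) * ω.1 = X.ofA a * ω.1 + X.ofA b * ω.1 by rw [map_add, add_mul])
  zero_smul ω := Subtype.ext (show X.ofA 0 * ω.1 = 0 by simp)

variable {X}

@[ext] lemma Form.ext {m : ℕ} {ω η : X.Form m} (h : ω.1 = η.1) : ω = η := Subtype.ext h

@[simp] lemma Form.val_add {m : ℕ} (ω η : X.Form m) : (ω + η).1 = ω.1 + η.1 := rfl
@[simp] lemma Form.val_zero {m : ℕ} : (0 : X.Form m).1 = 0 := rfl
@[simp] lemma Form.val_smul {m : ℕ} (a : A) (ω : X.Form m) : (a • ω).1 = X.ofA a * ω.1 := rfl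

/-- The right action `ω a` of `A` on `Ωᵐ`. -/
def Form.rmul {m : ℕ} (ω : X.Form m) (a : A) : X.Form m := ⟨ω.1 * X.ofA a, X.right_mem a ω.2⟩

@[simp] lemma Form.val_rmul {m : ℕ} (ω : X.Form m) (a : A) : (ω.rmul a).1 = ω.1 * X.ofA a := rfl

/-- The wedge product of two `1`-forms. -/
def wedge (ω η : X.Form 1) : X.Form 2 := ⟨ω.1 * η.1, SetLike.mul_mem_graded ω.2 η.2⟩

@[simp] lemma val_wedge (ω η : X.Form 1) : (wedge ω η).1 = ω.1 * η.1 := rfl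

variable (X) in
/-- The differential `d : A → Ω¹`. -/
def dA (a : A) : X.Form 1 := ⟨X.d (X.ofA a), by simpa using X.d_mem (X.ofA_mem a)⟩

@[simp] lemma val_dA (a : A) : (X.dA a).1 = X.d (X.ofA a) := rfl

/-- The differential `d : Ω¹ → Ω²`. -/
def dForm (ω : X.Form 1) : X.Form 2 := ⟨X.d ω.1, X.d_mem ω.2⟩

@[simp] lemma val_dForm (ω : X.Form 1) : (dForm ω).1 = X.d ω.1 := rfl

lemma d_ofA_mul (a : A) (η : X.Ω) :
    X.d (X.ofA a * η) = X.d (X.ofA a) * η + X.ofA a * X.d η := by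
  simpa using X.leibniz (X.ofA_mem a) η

lemma d_one_mul (ω : X.Form 1) (η : X.Ω) : X.d (ω.1 * η) = X.d ω.1 * η - ω.1 * X.d η := by
  simpa [sub_eq_add_neg] using X.leibniz ω.2 η

lemma dA_mul (a b : A) : X.dA (a * b) = (X.dA a).rmul b + a • X.dA b := by
  ext; simp [d_ofA_mul]

lemma dA_add (a b : A) : X.dA (a + b) = X.dA a + X.dA b := by
  ext; simp

lemma dA_algebraMap (c : k) : X.dA (algebraMap k A c) = 0 := by
  have h1 : X.d (1 : X.Ω) = 0 := by
    have h := d_ofA_mul (X := X) 1 1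
    simpa using h
  ext
  simp [Algebra.algebraMap_eq_smul_one, h1]

/-! ### The functors `Ωᵐ ⊗_A -` -/

section Tensor

variable (X)

/-- The relations `ω a ⊗ e = ω ⊗ a e` in `Ωᵐ ⊗_ℤ M`. -/
def balancing (m : ℕ) (M : Type u) [AddCommGroup M] [Module A M] :
    Submodule A (X.Form m ⊗[ℤ] M) :=
  Submodule.span A
    {x | ∃ (ω : X.Form m) (a : A) (e : M), x = ω.rmul a ⊗ₜ[ℤ] e - ω ⊗ₜ[ℤ] (a • e)}

/-- The left `A`-module `Ωᵐ ⊗_A M`. -/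
def FormTensor (m : ℕ) (M : Type u) [AddCommGroup M] [Module A M] : Type u :=
  (X.Form m ⊗[ℤ] M) ⧸ X.balancing m M

variable {M N P : Type u} [AddCommGroup M] [Module A M] [AddCommGroup N] [Module A N]
  [AddCommGroup P] {m : ℕ}

instance : AddCommGroup (X.FormTensor m M) :=
  inferInstanceAs (AddCommGroup ((X.Form m ⊗[ℤ] M) ⧸ X.balancing m M))

instance : Module A (X.FormTensor m M) :=
  inferInstanceAs (Module A ((X.Form m ⊗[ℤ] M) ⧸ X.balancing m M))

variable {X}

variable (X) in
/-- The projection `Ωᵐ ⊗_ℤ M → Ωᵐ ⊗_A M`. -/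
def tproj (m : ℕ) (M : Type u) [AddCommGroup M] [Module A M] :
    X.Form m ⊗[ℤ] M →ₗ[A] X.FormTensor m M := (X.balancing m M).mkQ

/-- The pure tensor `ω ⊗_A e`. -/
def tmk (ω : X.Form m) (e : M) : X.FormTensor m M := X.tproj m M (ω ⊗ₜ[ℤ] e)

lemma add_tmk (ω η : X.Form m) (e : M) : tmk (ω + η) e = tmk ω e + tmk η e := by
  simp only [tmk, TensorProduct.add_tmul, map_add]

lemma tmk_add (ω : X.Form m) (e f : M) : tmk ω (e + f) = tmk ω e + tmk ω f := by
  simp only [tmk, TensorProduct.tmul_add, map_add]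

lemma smul_tmk (a : A) (ω : X.Form m) (e : M) : a • tmk ω e = tmk (a • ω) e :=
  ((X.tproj m M).map_smul a (ω ⊗ₜ[ℤ] e)).symm

lemma rmul_tmk (ω : X.Form m) (a : A) (e : M) : tmk (ω.rmul a) e = tmk ω (a • e) := by
  have h : X.tproj m M (ω.rmul a ⊗ₜ[ℤ] e - ω ⊗ₜ[ℤ] (a • e)) = 0 :=
    (Submodule.Quotient.mk_eq_zero _).2 (Submodule.subset_span ⟨ω, a, e, rfl⟩)
  rwa [map_sub, sub_eq_zero] at h

lemma zero_tmk (e : M) : tmk (0 : X.Form m) e = 0 := by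
  simp only [tmk, TensorProduct.zero_tmul, map_zero]

lemma tmk_zero (ω : X.Form m) : tmk ω (0 : M) = 0 := by
  simp only [tmk, TensorProduct.tmul_zero, map_zero]

lemma FormTensor.induction {p : X.FormTensor m M → Prop} (h0 : p 0)
    (ht : ∀ ω e, p (tmk ω e)) (ha : ∀ x y, p x → p y → p (x + y)) (x : X.FormTensor m M) : p x := by
  obtain ⟨y, rfl⟩ : ∃ y, X.tproj m M y = x := (X.balancing m M).mkQ_surjective x
  induction y using TensorProduct.induction_on with
  | zero => rw [map_zero]; exact h0
  | tmul ω e => exact ht ω e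
  | add y z hy hz => rw [map_add]; exact ha _ _ hy hz

/-- The additive map out of `Ωᵐ ⊗_A M` given by a balanced biadditive map. -/
def FormTensor.lift (f : X.Form m →+ M →+ P)
    (hf : ∀ ω a e, f (ω.rmul a) e = f ω (a • e)) : X.FormTensor m M →+ P :=
  let g : X.Form m ⊗[ℤ] M →+ P := TensorProduct.liftAddHom f (by
    intro c ω e; simp)
  QuotientAddGroup.lift (X.balancing m M).toAddSubgroup g (by
    intro x hx
    have key : ∀ b : A, g (b • x) = 0 := by
      refine Submodule.span_induction (p := fun x _ => ∀ b : A, g (b • x) = 0) ?_ ?_ ?_ ?_ hx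
      · rintro _ ⟨ω, a, e, rfl⟩ b
        have h : (b • ω.rmul a) = (b • ω).rmul a := by ext; simp [mul_assoc]
        rw [smul_sub, TensorProduct.smul_tmul', TensorProduct.smul_tmul', map_sub, h, sub_eq_zero]
        exact hf _ _ _
      · intro b; simp
      · intro x y _ _ hx hy b; rw [smul_add, map_add, hx, hy, add_zero]
      · intro a x _ hx b; rw [smul_smul]; exact hx _
    simpa using key 1)

@[simp] lemma FormTensor.lift_tmk (f : X.Form m →+ M →+ P)
    (hf : ∀ ω a e, f (ω.rmul a) e = f ω (a • e)) (ω : X.Form m) (e : M) :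
    FormTensor.lift f hf (tmk ω e) = f ω e := rfl

/-- The functor `Ωᵐ ⊗_A -` on morphisms. -/
def FormTensor.map (φ : M →ₗ[A] N) : X.FormTensor m M →ₗ[A] X.FormTensor m N where
  toFun := FormTensor.lift
    (AddMonoidHom.mk' (fun ω => AddMonoidHom.mk' (fun e => tmk ω (φ e))
      (fun e f => by rw [map_add, tmk_add]))
      (fun ω η => by ext e; exact add_tmk ω η (φ e)))
    (fun ω a e => by
      change tmk (ω.rmul a) (φ e) = tmk ω (φ (a • e))
      rw [map_smul, rmul_tmk])
  map_add' := map_add _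
  map_smul' a x := by
    induction x using FormTensor.induction with
    | h0 => simp
    | ht ω e => rw [smul_tmk]; exact (smul_tmk a ω (φ e)).symm
    | ha x y hx hy => rw [smul_add, map_add, hx, hy, map_add, smul_add]

@[simp] lemma FormTensor.map_tmk (φ : M →ₗ[A] N) (ω : X.Form m) (e : M) :
    FormTensor.map φ (tmk ω e) = tmk ω (φ e) := rfl

/-- The additive map `ω ∧ - : Ω¹ ⊗_A M → Ω² ⊗_A M`, `η ⊗ e ↦ (ω ∧ η) ⊗ e`. -/
def wedgeLeft (ω : X.Form 1) : X.FormTensor 1 M →+ X.FormTensor 2 M :=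
  FormTensor.lift
    (AddMonoidHom.mk' (fun η => AddMonoidHom.mk' (fun e => tmk (wedge ω η) e)
      (fun e f => tmk_add _ e f))
      (fun η θ => by
        ext e
        change tmk (wedge ω (η + θ)) e = tmk (wedge ω η) e + tmk (wedge ω θ) e
        rw [← add_tmk]; congr 1; ext; simp [mul_add]))
    (fun η a e => by
      change tmk (wedge ω (η.rmul a)) e = tmk (wedge ω η) (a • e)
      rw [← rmul_tmk]; congr 1; ext; simp [mul_assoc])

@[simp] lemma wedgeLeft_tmk (ω η : X.Form 1) (e : M) :
    wedgeLeft ω (tmk η e) = tmk (wedge ω η) e := rfl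

lemma wedgeLeft_add (ω η : X.Form 1) (x : X.FormTensor 1 M) :
    wedgeLeft (ω + η) x = wedgeLeft ω x + wedgeLeft η x := by
  induction x using FormTensor.induction with
  | h0 => simp
  | ht θ e =>
    simp only [wedgeLeft_tmk, ← add_tmk]; congr 1; ext; simp [add_mul]
  | ha x y hx hy => simp only [map_add, hx, hy]; abel

lemma wedgeLeft_rmul (ω : X.Form 1) (a : A) (x : X.FormTensor 1 M) :
    wedgeLeft (ω.rmul a) x = wedgeLeft ω (a • x) := by
  induction x using FormTensor.induction with
  | h0 => simp
  | ht θ e =>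
    rw [smul_tmk]; simp only [wedgeLeft_tmk]; congr 1; ext; simp [mul_assoc]
  | ha x y hx hy => simp only [map_add, smul_add, hx, hy]

lemma wedgeLeft_smul (a : A) (ω : X.Form 1) (x : X.FormTensor 1 M) :
    wedgeLeft (a • ω) x = a • wedgeLeft ω x := by
  induction x using FormTensor.induction with
  | h0 => simp
  | ht θ e =>
    simp only [wedgeLeft_tmk, smul_tmk]; congr 1; ext; simp [mul_assoc]
  | ha x y hx hy => simp only [map_add, smul_add, hx, hy]

lemma wedgeLeft_map (φ : M →ₗ[A] N) (ω : X.Form 1) (x : X.FormTensor 1 M) :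
    wedgeLeft ω (FormTensor.map φ x) = FormTensor.map φ (wedgeLeft ω x) := by
  induction x using FormTensor.induction with
  | h0 => simp
  | ht θ e => simp
  | ha x y hx hy => simp only [map_add, hx, hy]

/-- The wedge product `Ω¹ ⊗_A Ω¹ ⊗_A M → Ω² ⊗_A M`, `ω ⊗ η ⊗ e ↦ (ω ∧ η) ⊗ e`. -/
def wedgeTensor : X.FormTensor 1 (X.FormTensor 1 M) →ₗ[A] X.FormTensor 2 M where
  toFun := FormTensor.lift
    (AddMonoidHom.mk' (fun ω => wedgeLeft ω) (fun ω η => by ext x; exact wedgeLeft_add ω η x))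
    (fun ω a x => wedgeLeft_rmul ω a x)
  map_add' := map_add _
  map_smul' a x := by
    induction x using FormTensor.induction with
    | h0 => simp
    | ht ω e => rw [smul_tmk]; exact wedgeLeft_smul a ω e
    | ha x y hx hy => rw [smul_add, map_add, hx, hy, map_add, smul_add]

@[simp] lemma wedgeTensor_tmk (ω : X.Form 1) (x : X.FormTensor 1 M) :
    wedgeTensor (tmk ω x) = wedgeLeft ω x := rfl

lemma FormTensor.map_comp_apply {Q : Type u} [AddCommGroup Q] [Module A Q] (ψ : N →ₗ[A] Q)
    (φ : M →ₗ[A] N) (x : X.FormTensor m M) :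
    FormTensor.map ψ (FormTensor.map φ x) = FormTensor.map (ψ ∘ₗ φ) x := by
  induction x using FormTensor.induction with
  | h0 => simp
  | ht ω e => simp
  | ha x y hx hy => simp only [map_add, hx, hy]

lemma FormTensor.map_zero_apply (x : X.FormTensor m M) :
    FormTensor.map (0 : M →ₗ[A] N) x = 0 := by
  induction x using FormTensor.induction with
  | h0 => simp
  | ht ω e => simp [tmk_zero]
  | ha x y hx hy => simp only [map_add, hx, hy, add_zero]

lemma wedgeTensor_map (φ : M →ₗ[A] N) (x : X.FormTensor 1 (X.FormTensor 1 M)) :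
    wedgeTensor (FormTensor.map (FormTensor.map φ) x) = FormTensor.map φ (wedgeTensor x) := by
  induction x using FormTensor.induction with
  | h0 => simp
  | ht ω e => simp [wedgeLeft_map]
  | ha x y hx hy => simp only [map_add, hx, hy]

end Tensor
/-! ### First order jets -/

section JetOne

variable (X)

/-- The first jet module `J¹M = J¹A ⊗_A M`, where `J¹A = (A ⊗ A) / N` and `N` is the kernel of
`∑ aᵢ ⊗ bᵢ ↦ (∑ aᵢ bᵢ, ∑ aᵢ dbᵢ)`.  It is presented through its decomposition
`J¹M = j¹(M) ⊕ ι¹(Ω¹ ⊗_A M)` as an abelian group: the pair `(e, ω)` stands for `j¹(e) + ι¹(ω)`.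
The class `[a ⊗ b] ⊗ e = a j¹(b e)` is the pair `(a b e, - da ⊗ b e)`, so that
`ι¹(da ⊗ e) = j¹(a e) - a j¹(e)`. -/
def JetOne (M : Type u) [AddCommGroup M] [Module A M] : Type u := M × X.FormTensor 1 M

variable {M N : Type u} [AddCommGroup M] [Module A M] [AddCommGroup N] [Module A N]

instance : AddCommGroup (X.JetOne M) := inferInstanceAs (AddCommGroup (M × X.FormTensor 1 M))

/-- The left `A`-module structure of `J¹M`: it is determined by `a j¹(e) = j¹(a e) - ι¹(da ⊗ e)`
and by the linearity of `ι¹`. -/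
instance : Module A (X.JetOne M) where
  smul a x := (a • x.1, a • x.2 - tmk (X.dA a) x.1)
  one_smul x := by
    have h : X.dA (1 : A) = 0 := by simpa using dA_algebraMap (X := X) (1 : k)
    refine Prod.ext (one_smul A x.1) ?_
    change (1 : A) • x.2 - tmk (X.dA 1) x.1 = x.2
    rw [h, zero_tmk, one_smul, sub_zero]
  mul_smul a b x := by
    refine Prod.ext (mul_smul a b x.1) ?_
    change (a * b) • x.2 - tmk (X.dA (a * b)) x.1
      = a • (b • x.2 - tmk (X.dA b) x.1) - tmk (X.dA a) (b • x.1)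
    rw [dA_mul, add_tmk, rmul_tmk, smul_sub, smul_tmk, mul_smul]; abel
  smul_zero a := by
    refine Prod.ext (smul_zero a) ?_
    change a • (0 : X.FormTensor 1 M) - tmk (X.dA a) 0 = 0
    rw [smul_zero, tmk_zero, sub_zero]
  smul_add a x y := by
    refine Prod.ext (smul_add a x.1 y.1) ?_
    change a • (x.2 + y.2) - tmk (X.dA a) (x.1 + y.1)
      = (a • x.2 - tmk (X.dA a) x.1) + (a • y.2 - tmk (X.dA a) y.1)
    rw [smul_add, tmk_add]; abel
  add_smul a b x := by
    refine Prod.ext (add_smul a b x.1) ?_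
    change (a + b) • x.2 - tmk (X.dA (a + b)) x.1
      = (a • x.2 - tmk (X.dA a) x.1) + (b • x.2 - tmk (X.dA b) x.1)
    rw [add_smul, dA_add, add_tmk]; abel
  zero_smul x := by
    have h : X.dA (0 : A) = 0 := by simpa using dA_algebraMap (X := X) (0 : k)
    refine Prod.ext (zero_smul A x.1) ?_
    change (0 : A) • x.2 - tmk (X.dA 0) x.1 = 0
    rw [h, zero_tmk, zero_smul, sub_zero]

variable {X}

lemma JetOne.smul_fst (a : A) (x : X.JetOne M) : (a • x).1 = a • x.1 := rfl

lemma JetOne.smul_snd (a : A) (x : X.JetOne M) :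
    (a • x).2 = a • x.2 - tmk (X.dA a) x.1 := rfl

/-- The jet projection `π^{1,0} : J¹M → M`. -/
def JetOne.proj : X.JetOne M →ₗ[A] M where
  toFun x := x.1
  map_add' _ _ := rfl
  map_smul' _ _ := rfl

/-- The jet prolongation `j¹ : M → J¹M`. -/
def JetOne.prolong : M →+ X.JetOne M := AddMonoidHom.inl M (X.FormTensor 1 M)

/-- The inclusion `ι¹ : Ω¹ ⊗_A M → J¹M`. -/
def JetOne.iota : X.FormTensor 1 M →ₗ[A] X.JetOne M where
  toFun ω := (0, ω)
  map_add' ω η := Prod.ext (add_zero (0 : M)).symm rfl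
  map_smul' a ω := by
    refine Prod.ext (smul_zero a).symm ?_
    change a • ω = a • ω - tmk (X.dA a) 0
    rw [tmk_zero, sub_zero]

/-- The functor `J¹` on morphisms. -/
def JetOne.map (φ : M →ₗ[A] N) : X.JetOne M →ₗ[A] X.JetOne N where
  toFun x := (φ x.1, FormTensor.map φ x.2)
  map_add' x y := Prod.ext (map_add φ x.1 y.1) (map_add _ x.2 y.2)
  map_smul' a x := by
    refine Prod.ext (map_smul φ a x.1) ?_
    change FormTensor.map φ (a • x.2 - tmk (X.dA a) x.1)
      = a • FormTensor.map φ x.2 - tmk (X.dA a) (φ x.1)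
    rw [map_sub, map_smul, FormTensor.map_tmk]

/-- For a `1`-form `ω`, the additive map `J¹M → Ω² ⊗_A M`, `(e, θ) ↦ dω ⊗ e + ω ∧ θ`; it sends
`[a ⊗ b] ⊗ e` to `d(ω a) b ⊗ e`. -/
def spencerLeft (ω : X.Form 1) : X.JetOne M →+ X.FormTensor 2 M :=
  AddMonoidHom.mk' (fun x => tmk (dForm ω) x.1 + wedgeLeft ω x.2) (fun x y => by
    change tmk (dForm ω) (x.1 + y.1) + wedgeLeft ω (x.2 + y.2) = _
    rw [tmk_add, map_add]; abel)

lemma spencerLeft_apply (ω : X.Form 1) (x : X.JetOne M) :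
    spencerLeft ω x = tmk (dForm ω) x.1 + wedgeLeft ω x.2 := rfl

/-- The Spencer operator `Ω¹ ⊗_A J¹M → Ω² ⊗_A M`, `ω ⊗ [a ⊗ b] ⊗ e ↦ d(ω a) b ⊗ e`. -/
def spencer : X.FormTensor 1 (X.JetOne M) →+ X.FormTensor 2 M :=
  FormTensor.lift
    (AddMonoidHom.mk' (fun ω => spencerLeft ω) (fun ω η => by
      ext x
      change tmk (dForm (ω + η)) x.1 + wedgeLeft (ω + η) x.2
        = (tmk (dForm ω) x.1 + wedgeLeft ω x.2) + (tmk (dForm η) x.1 + wedgeLeft η x.2)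
      have h : dForm (ω + η) = dForm ω + dForm η := by ext; simp
      rw [h, add_tmk, wedgeLeft_add]; abel))
    (fun ω a x => by
      change tmk (dForm (ω.rmul a)) x.1 + wedgeLeft (ω.rmul a) x.2
        = tmk (dForm ω) (a • x.1) + wedgeLeft ω (a • x.2 - tmk (X.dA a) x.1)
      have h : dForm (ω.rmul a) + wedge ω (X.dA a) = (dForm ω).rmul a := by
        ext; simp [d_one_mul]
      rw [map_sub, wedgeLeft_rmul, wedgeLeft_tmk, ← rmul_tmk, ← h, add_tmk]; abel)

lemma spencer_tmk (ω : X.Form 1) (x : X.JetOne M) :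
    spencer (tmk ω x) = tmk (dForm ω) x.1 + wedgeLeft ω x.2 := rfl

lemma spencer_smul (a : A) (ξ : X.FormTensor 1 (X.JetOne M)) :
    spencer (a • ξ) = a • spencer ξ + wedgeLeft (X.dA a) (FormTensor.map JetOne.proj ξ) := by
  induction ξ using FormTensor.induction with
  | h0 => simp
  | ht ω x =>
    have h : dForm (a • ω) = a • dForm ω + wedge (X.dA a) ω := by
      ext; simp [d_ofA_mul, add_comm]
    rw [smul_tmk, spencer_tmk, spencer_tmk, FormTensor.map_tmk, wedgeLeft_tmk, h, add_tmk,
      smul_add, smul_tmk, wedgeLeft_smul]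
    change _ = _ + tmk (wedge (X.dA a) ω) x.1
    abel
  | ha x y hx hy => simp only [smul_add, map_add, hx, hy]; abel

lemma spencer_map_iota (ξ : X.FormTensor 1 (X.FormTensor 1 M)) :
    spencer (FormTensor.map JetOne.iota ξ) = wedgeTensor ξ := by
  induction ξ using FormTensor.induction with
  | h0 => simp
  | ht ω x =>
    rw [FormTensor.map_tmk, spencer_tmk, wedgeTensor_tmk]
    change tmk (dForm ω) (0 : M) + wedgeLeft ω x = _
    rw [tmk_zero, zero_add]
  | ha x y hx hy => simp only [map_add, hx, hy]

variable (X) in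
/-- The left `A`-module `(Ω¹ ⋉ Ω²) ⊗_A M`: the abelian group `Ω¹ ⊗_A M ⊕ Ω² ⊗_A M` with the action
`a (α + β) = a α + (da ∧ α + a β)`. -/
def Twisted (M : Type u) [AddCommGroup M] [Module A M] : Type u :=
  X.FormTensor 1 M × X.FormTensor 2 M

instance : AddCommGroup (X.Twisted M) :=
  inferInstanceAs (AddCommGroup (X.FormTensor 1 M × X.FormTensor 2 M))

lemma wedgeLeft_zero (x : X.FormTensor 1 M) : wedgeLeft (0 : X.Form 1) x = 0 := by
  have h := wedgeLeft_add (0 : X.Form 1) 0 x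
  simpa using h

instance : Module A (X.Twisted M) where
  smul a x := (a • x.1, wedgeLeft (X.dA a) x.1 + a • x.2)
  one_smul x := by
    have h : X.dA (1 : A) = 0 := by simpa using dA_algebraMap (X := X) (1 : k)
    refine Prod.ext (one_smul A x.1) ?_
    change wedgeLeft (X.dA 1) x.1 + (1 : A) • x.2 = x.2
    rw [h, wedgeLeft_zero, one_smul, zero_add]
  mul_smul a b x := by
    refine Prod.ext (mul_smul a b x.1) ?_
    change wedgeLeft (X.dA (a * b)) x.1 + (a * b) • x.2
      = wedgeLeft (X.dA a) (b • x.1) + a • (wedgeLeft (X.dA b) x.1 + b • x.2)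
    rw [dA_mul, wedgeLeft_add, wedgeLeft_rmul, smul_add, wedgeLeft_smul, mul_smul]; abel
  smul_zero a := by
    refine Prod.ext (smul_zero a) ?_
    change wedgeLeft (X.dA a) 0 + a • (0 : X.FormTensor 2 M) = 0
    rw [map_zero, smul_zero, add_zero]
  smul_add a x y := by
    refine Prod.ext (smul_add a x.1 y.1) ?_
    change wedgeLeft (X.dA a) (x.1 + y.1) + a • (x.2 + y.2)
      = (wedgeLeft (X.dA a) x.1 + a • x.2) + (wedgeLeft (X.dA a) y.1 + a • y.2)
    rw [map_add, smul_add]; abel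
  add_smul a b x := by
    refine Prod.ext (add_smul a b x.1) ?_
    change wedgeLeft (X.dA (a + b)) x.1 + (a + b) • x.2
      = (wedgeLeft (X.dA a) x.1 + a • x.2) + (wedgeLeft (X.dA b) x.1 + b • x.2)
    rw [dA_add, wedgeLeft_add, add_smul]; abel
  zero_smul x := by
    have h : X.dA (0 : A) = 0 := by simpa using dA_algebraMap (X := X) (0 : k)
    refine Prod.ext (zero_smul A x.1) ?_
    change wedgeLeft (X.dA 0) x.1 + (0 : A) • x.2 = 0
    rw [h, wedgeLeft_zero, zero_smul, zero_add]

/-- The `A`-linear map `D = (D^I, D^II) : J¹J¹M → (Ω¹ ⋉ Ω²) ⊗_A M` given by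
`[a ⊗ b] ⊗ [c ⊗ e] ↦ a d(bc) ⊗ e + da ∧ d(bc) ⊗ e`.  Its first component is characterized by
`ι¹ ∘ D^I = J¹(π^{1,0}) - π^{1,0}_{J¹M}`; the second is the composite of the two Spencer operators
`J¹J¹M → Ω¹ ⊗_A J¹M → Ω² ⊗_A M`, up to sign. -/
def jetD : X.JetOne (X.JetOne M) →ₗ[A] X.Twisted M where
  toFun x := (FormTensor.map JetOne.proj x.2 - x.1.2, spencer x.2)
  map_add' x y := by
    refine Prod.ext ?_ (map_add spencer x.2 y.2)
    change FormTensor.map JetOne.proj (x.2 + y.2) - (x.1.2 + y.1.2)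
      = (FormTensor.map JetOne.proj x.2 - x.1.2) + (FormTensor.map JetOne.proj y.2 - y.1.2)
    rw [map_add]; abel
  map_smul' a x := by
    refine Prod.ext ?_ ?_
    · change FormTensor.map JetOne.proj (a • x.2 - tmk (X.dA a) x.1)
          - (a • x.1.2 - tmk (X.dA a) x.1.1) = a • (FormTensor.map JetOne.proj x.2 - x.1.2)
      rw [map_sub, map_smul, FormTensor.map_tmk, smul_sub]
      change a • _ - tmk (X.dA a) x.1.1 - _ = _
      abel
    · change spencer (a • x.2 - tmk (X.dA a) x.1)
        = wedgeLeft (X.dA a) (FormTensor.map JetOne.proj x.2 - x.1.2) + a • spencer x.2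
      have h : dForm (X.dA a) = 0 := by ext; simp [X.d_d]
      rw [map_sub, spencer_smul, spencer_tmk, h, zero_tmk, map_sub]; abel

end JetOne

/-! ### Holonomic jets, symmetric forms and the jet sequence -/

section Jets

variable (X)

/-- Two consecutive jet modules `low = JⁿE`, `high = Jⁿ⁺¹E` with `l : Jⁿ⁺¹E → J¹JⁿE`. -/
structure JetStage where
  low : ModuleCat.{u} A
  high : ModuleCat.{u} A
  l : high →ₗ[A] X.JetOne low

/-- The holonomic jets of all orders, by recursion: `J⁰E = E`, `J¹E` is the first jet module and
`Jⁿ⁺²E` is the kernel of `D ∘ J¹(l) : J¹Jⁿ⁺¹E → J¹J¹JⁿE → (Ω¹ ⋉ Ω²) ⊗_A JⁿE`, where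
`l : Jⁿ⁺¹E → J¹JⁿE` is the inclusion. -/
def jetStage (E : ModuleCat.{u} A) : ℕ → X.JetStage
  | 0 => ⟨E, ModuleCat.of A (X.JetOne E), LinearMap.id⟩
  | n + 1 =>
    ⟨(jetStage E n).high,
      ModuleCat.of A (LinearMap.ker (jetD ∘ₗ JetOne.map (jetStage E n).l)),
      Submodule.subtype _⟩

/-- The module `JⁿE` of holonomic `n`-jets. -/
def Jet (n : ℕ) (E : ModuleCat.{u} A) : ModuleCat.{u} A := (X.jetStage E n).low

/-- The module `Jⁿ⁻¹E`, with the convention `J⁻¹E = 0`. -/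
def JetPred (E : ModuleCat.{u} A) : ℕ → ModuleCat.{u} A
  | 0 => ModuleCat.of A PUnit
  | n + 1 => X.Jet n E

/-- The inclusion `l^{1,n} : Jⁿ⁺¹E → J¹JⁿE`. -/
def jetL (n : ℕ) (E : ModuleCat.{u} A) : X.Jet (n + 1) E →ₗ[A] X.JetOne (X.Jet n E) :=
  (X.jetStage E n).l

lemma jetL_injective (n : ℕ) (E : ModuleCat.{u} A) : Function.Injective (X.jetL n E) := by
  cases n with
  | zero => exact fun _ _ h => h
  | succ n => exact Subtype.val_injective

lemma exists_jetL (n : ℕ) (E : ModuleCat.{u} A) (x : X.JetOne (X.Jet (n + 1) E))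
    (hx : jetD (JetOne.map (X.jetL n E) x) = 0) : ∃ y, X.jetL (n + 1) E y = x :=
  ⟨⟨x, hx⟩, rfl⟩

/-- The jet projection `π^{n,n-1} : JⁿE → Jⁿ⁻¹E`. -/
def jetProj (E : ModuleCat.{u} A) : (n : ℕ) → X.Jet n E →ₗ[A] X.JetPred E n
  | 0 => 0
  | n + 1 => JetOne.proj ∘ₗ X.jetL n E

lemma jetD_prolong (S : X.JetStage) (x : S.high) (y : S.low) (h : S.l x = JetOne.prolong y) :
    jetD (JetOne.map S.l (JetOne.prolong x)) = 0 := by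
  refine Prod.ext ?_ ?_
  · change FormTensor.map JetOne.proj (FormTensor.map S.l (0 : X.FormTensor 1 S.high))
      - (S.l x).2 = 0
    rw [map_zero, map_zero, h]
    change (0 : X.FormTensor 1 S.low) - 0 = 0
    rw [sub_zero]
  · change spencer (FormTensor.map S.l (0 : X.FormTensor 1 S.high)) = 0
    rw [map_zero, map_zero]

/-- The prolongations `jⁿ` and `jⁿ⁺¹`, by recursion: `j⁰` is the identity, and `jⁿ⁺¹` is the map
with `l^{1,n} ∘ jⁿ⁺¹ = j¹ ∘ jⁿ`. -/
def prolongPair (E : ModuleCat.{u} A) : (n : ℕ) →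
    {p : (E →+ X.Jet n E) × (E →+ X.Jet (n + 1) E) //
      ∀ e, X.jetL n E (p.2 e) = JetOne.prolong (p.1 e)}
  | 0 => ⟨(AddMonoidHom.id E, JetOne.prolong), fun _ => rfl⟩
  | n + 1 =>
    ⟨((prolongPair E n).1.2,
      AddMonoidHom.mk' (fun e => (⟨JetOne.prolong ((prolongPair E n).1.2 e),
          X.jetD_prolong (X.jetStage E n) _ _ ((prolongPair E n).2 e)⟩ : X.Jet (n + 2) E))
        (fun e f => Subtype.ext
          ((congrArg (JetOne.prolong (X := X) (M := X.Jet (n + 1) E))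
            (map_add (prolongPair E n).1.2 e f)).trans
              (map_add (JetOne.prolong (X := X) (M := X.Jet (n + 1) E)) _ _)))),
      fun _ => rfl⟩

/-- The jet prolongation `jⁿ : E → JⁿE`, as an additive map. -/
def prolong (n : ℕ) (E : ModuleCat.{u} A) : E →+ X.Jet n E := (X.prolongPair E n).1.1

lemma jetL_prolong (n : ℕ) (E : ModuleCat.{u} A) (e : E) :
    X.jetL n E (X.prolong (n + 1) E e) = JetOne.prolong (X.prolong n E e) :=
  (X.prolongPair E n).2 e

lemma jetProj_prolong (n : ℕ) (E : ModuleCat.{u} A) (e : E) :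
    X.jetProj E (n + 1) (X.prolong (n + 1) E e) = X.prolong n E e :=
  congrArg JetOne.proj (X.jetL_prolong n E e)

lemma prolong_smul (n : ℕ) (E : ModuleCat.{u} A) (c : k) (e : E) :
    X.prolong n E (algebraMap k A c • e) = algebraMap k A c • X.prolong n E e := by
  induction n with
  | zero => rfl
  | succ n ih =>
    apply X.jetL_injective
    rw [(X.jetL n E).map_smul, jetL_prolong, jetL_prolong, ih]
    refine Prod.ext rfl ?_
    change (0 : X.FormTensor 1 (X.Jet n E)) = algebraMap k A c • 0 - tmk (X.dA (algebraMap k A c)) _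
    rw [dA_algebraMap, zero_tmk, smul_zero, sub_zero]

/-- Two consecutive modules of symmetric forms `low = SⁿE`, `high = Sⁿ⁺¹E` with
`l : Sⁿ⁺¹E → Ω¹ ⊗_A SⁿE`. -/
structure SymStage where
  low : ModuleCat.{u} A
  high : ModuleCat.{u} A
  l : high →ₗ[A] X.FormTensor 1 low

/-- The symmetric forms of all degrees, by recursion: `S⁰E = E`, `S¹E = Ω¹ ⊗_A E` and `Sⁿ⁺²E` is the
kernel of `Ω¹ ⊗_A Sⁿ⁺¹E → Ω¹ ⊗_A Ω¹ ⊗_A SⁿE → Ω² ⊗_A SⁿE`, where the second map is the wedge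
product. -/
def symStage (E : ModuleCat.{u} A) : ℕ → X.SymStage
  | 0 => ⟨E, ModuleCat.of A (X.FormTensor 1 E), LinearMap.id⟩
  | n + 1 =>
    ⟨(symStage E n).high,
      ModuleCat.of A (LinearMap.ker (wedgeTensor ∘ₗ FormTensor.map (m := 1) (symStage E n).l)),
      Submodule.subtype _⟩

/-- The module `SⁿE` of symmetric `n`-forms with values in `E`. -/
def Sym (n : ℕ) (E : ModuleCat.{u} A) : ModuleCat.{u} A := (X.symStage E n).low

/-- The inclusion `ι_∧ : Sⁿ⁺¹E → Ω¹ ⊗_A SⁿE`. -/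
def symL (n : ℕ) (E : ModuleCat.{u} A) : X.Sym (n + 1) E →ₗ[A] X.FormTensor 1 (X.Sym n E) :=
  (X.symStage E n).l

lemma jetD_iota (S : X.SymStage) (T : X.JetStage) (f : S.low →ₗ[A] T.low)
    (g : S.high →ₗ[A] T.high) (h : ∀ s, T.l (g s) = JetOne.iota (FormTensor.map f (S.l s)))
    (x : X.FormTensor 1 S.high) (hx : wedgeTensor (FormTensor.map S.l x) = 0) :
    jetD (JetOne.map T.l (JetOne.iota (FormTensor.map g x))) = 0 := by
  have h' : T.l ∘ₗ g = JetOne.iota ∘ₗ FormTensor.map f ∘ₗ S.l := LinearMap.ext h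
  refine Prod.ext ?_ ?_
  · change FormTensor.map JetOne.proj (FormTensor.map T.l (FormTensor.map g x)) - (T.l 0).2 = 0
    have h0 : (JetOne.proj : X.JetOne T.low →ₗ[A] T.low) ∘ₗ T.l ∘ₗ g = 0 := by
      rw [h']; rfl
    have h1 : FormTensor.map JetOne.proj (FormTensor.map T.l (FormTensor.map g x)) = 0 := by
      rw [FormTensor.map_comp_apply T.l g, FormTensor.map_comp_apply, h0,
        FormTensor.map_zero_apply]
    rw [h1, map_zero]
    exact sub_zero _
  · change spencer (FormTensor.map T.l (FormTensor.map g x)) = 0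
    rw [FormTensor.map_comp_apply, h', ← FormTensor.map_comp_apply, ← FormTensor.map_comp_apply,
      spencer_map_iota, wedgeTensor_map, hx, map_zero]

lemma FormTensor.map_id_apply {m : ℕ} {M : Type u} [AddCommGroup M] [Module A M]
    (x : X.FormTensor m M) : FormTensor.map (LinearMap.id : M →ₗ[A] M) x = x := by
  induction x using FormTensor.induction with
  | h0 => simp
  | ht ω e => simp
  | ha x y hx hy => simp only [map_add, hx, hy]

/-- The maps `ιⁿ` and `ιⁿ⁺¹`, by recursion: `ι⁰` is the identity, and `ιⁿ⁺¹` is the map with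
`l^{1,n} ∘ ιⁿ⁺¹ = ι¹ ∘ Ω¹(ιⁿ) ∘ ι_∧`. -/
def iotaPair (E : ModuleCat.{u} A) : (n : ℕ) →
    {p : (X.Sym n E →ₗ[A] X.Jet n E) × (X.Sym (n + 1) E →ₗ[A] X.Jet (n + 1) E) //
      ∀ s, X.jetL n E (p.2 s) = JetOne.iota (FormTensor.map p.1 (X.symL n E s))}
  | 0 => ⟨(LinearMap.id, JetOne.iota),
      fun s => congrArg JetOne.iota (FormTensor.map_id_apply X (M := E) s).symm⟩
  | n + 1 =>
    ⟨((iotaPair E n).1.2,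
      LinearMap.codRestrict _
        (JetOne.iota ∘ₗ FormTensor.map (iotaPair E n).1.2 ∘ₗ X.symL (n + 1) E)
        (fun s => X.jetD_iota (X.symStage E n) (X.jetStage E n) _ _ (iotaPair E n).2
          (X.symL (n + 1) E s) s.2)),
      fun _ => rfl⟩

/-- The natural map `ιⁿ : SⁿE → JⁿE`. -/
def iota (n : ℕ) (E : ModuleCat.{u} A) : X.Sym n E →ₗ[A] X.Jet n E := (X.iotaPair E n).1.1

lemma jetL_iota (n : ℕ) (E : ModuleCat.{u} A) (s : X.Sym (n + 1) E) :
    X.jetL n E (X.iota (n + 1) E s) = JetOne.iota (FormTensor.map (X.iota n E) (X.symL n E s)) :=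
  (X.iotaPair E n).2 s

lemma jetProj_iota (n : ℕ) (E : ModuleCat.{u} A) (s : X.Sym n E) :
    X.jetProj E n (X.iota n E s) = 0 := by
  cases n with
  | zero => rfl
  | succ n => exact congrArg JetOne.proj (X.jetL_iota n E s)

/-- The submodule `A jⁿ(E)` of elemental jets in `JⁿE`. -/
def elementalJet (n : ℕ) (E : ModuleCat.{u} A) : Submodule A (X.Jet n E) :=
  Submodule.span A (Set.range (X.prolong n E))

/-- The `n`-jet sequence `0 → SⁿE → JⁿE → Jⁿ⁻¹E → 0` is split exact. -/
structure JetSequenceSplitExact (n : ℕ) (E : ModuleCat.{u} A) : Prop where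
  injective : Function.Injective (X.iota n E)
  exact : Function.Exact (X.iota n E) (X.jetProj E n)
  surjective : Function.Surjective (X.jetProj E n)
  split : ∃ C : X.JetPred E n →ₗ[A] X.Jet n E, X.jetProj E n ∘ₗ C = LinearMap.id

/-- The (left) `n`-connections on `E`: the `A`-linear sections `Jⁿ⁻¹E → JⁿE` of the jet
projection. -/
def Connection (n : ℕ) (E : ModuleCat.{u} A) : Type u :=
  {C : X.JetPred E n →ₗ[A] X.Jet n E // X.jetProj E n ∘ₗ C = LinearMap.id}

variable {X} in
/-- The left splitting `λ : JⁿE → SⁿE` associated to an `n`-connection `C`: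
`ιⁿ(λ(x)) = x - C(π(x))`. -/
def leftSplitting {n : ℕ} {E : ModuleCat.{u} A} (h : X.JetSequenceSplitExact n E)
    (C : X.Connection n E) : X.Jet n E →ₗ[A] X.Sym n E :=
  (LinearEquiv.ofInjective (X.iota n E) h.injective).symm.toLinearMap ∘ₗ
    LinearMap.codRestrict (LinearMap.range (X.iota n E))
      (LinearMap.id - C.1 ∘ₗ X.jetProj E n) (fun x => by
        refine (h.exact _).1 ?_
        have hC := LinearMap.congr_fun C.2 (X.jetProj E n x)
        change X.jetProj E n (C.1 (X.jetProj E n x)) = X.jetProj E n x at hC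
        change X.jetProj E n (x - C.1 (X.jetProj E n x)) = 0
        rw [map_sub, hC, sub_self])

lemma iota_leftSplitting {n : ℕ} {E : ModuleCat.{u} A} (h : X.JetSequenceSplitExact n E)
    (C : X.Connection n E) (x : X.Jet n E) :
    X.iota n E (leftSplitting h C x) = x - C.1 (X.jetProj E n x) :=
  LinearEquiv.ofInjective_symm_apply (h := h.injective) (X.iota n E) _

lemma leftSplitting_comp_iota {n : ℕ} {E : ModuleCat.{u} A} (h : X.JetSequenceSplitExact n E)
    (C : X.Connection n E) : leftSplitting h C ∘ₗ X.iota n E = LinearMap.id := by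
  ext s
  apply h.injective
  change X.iota n E (leftSplitting h C (X.iota n E s)) = X.iota n E s
  rw [iota_leftSplitting, jetProj_iota, map_zero, sub_zero]

end Jets

/-! ### Differential operators, symbols and quantizations -/

section Operators

/-- The forgetful functor from left `A`-modules to `k`-modules. -/
abbrev forgetA (k : Type w) [CommRing k] (A : Type v) [Ring A] [Algebra k A] :
    ModuleCat.{u} A ⥤ ModuleCat.{u} k := ModuleCat.restrictScalars (algebraMap k A)

/-- An `A`-linear map, seen as a `k`-linear map. -/
def toK {M N : ModuleCat.{u} A} (φ : M →ₗ[A] N) :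
    (forgetA k A).obj M →ₗ[k] (forgetA k A).obj N :=
  ((forgetA k A).map (ModuleCat.ofHom φ)).hom

variable (X)

/-- The jet prolongation `jⁿ : E → JⁿE`, as a `k`-linear map. -/
def prolongK (n : ℕ) (E : ModuleCat.{u} A) :
    (forgetA k A).obj E →ₗ[k] (forgetA k A).obj (X.Jet n E) where
  toFun := X.prolong n E
  map_add' := map_add (X.prolong n E)
  map_smul' c e := X.prolong_smul n E c e

/-- The `k`-module `Diffⁿ(E, F)` of linear differential operators `E → F` of order at most `n`: the
`k`-linear maps that factor as `L ∘ jⁿ` for an `A`-linear map `L : JⁿE → F`, called a lift. -/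
def Diff (n : ℕ) (E F : ModuleCat.{u} A) :
    Submodule k ((forgetA k A).obj E →ₗ[k] (forgetA k A).obj F) where
  carrier := {Δ | ∃ L : X.Jet n E →ₗ[A] F, Δ = toK L ∘ₗ X.prolongK n E}
  zero_mem' := ⟨0, rfl⟩
  add_mem' := by
    rintro _ _ ⟨L, rfl⟩ ⟨L', rfl⟩
    exact ⟨L + L', rfl⟩
  smul_mem' := by
    rintro c _ ⟨L, rfl⟩
    refine ⟨{ toFun := fun x => algebraMap k A c • L x
              map_add' := fun x y => by rw [map_add, smul_add]
              map_smul' := fun a x => by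
                rw [map_smul, RingHom.id_apply, smul_smul, smul_smul, Algebra.commutes] }, rfl⟩

/-- `Diffⁿ⁻¹(E, F)`, with the convention `Diff⁻¹(E, F) = 0`. -/
def DiffPred (E F : ModuleCat.{u} A) :
    ℕ → Submodule k ((forgetA k A).obj E →ₗ[k] (forgetA k A).obj F)
  | 0 => ⊥
  | n + 1 => X.Diff n E F

/-- The `k`-module of symbols `Symbⁿ(E, F) = Diffⁿ(E, F) / Diffⁿ⁻¹(E, F)`. -/
abbrev Symb (n : ℕ) (E F : ModuleCat.{u} A) : Type u :=
  X.Diff n E F ⧸ (X.DiffPred E F n).comap (X.Diff n E F).subtype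

/-- Composition of differential operators `E → F` with an `A`-linear map `F → G`. -/
def diffMap (n : ℕ) (E : ModuleCat.{u} A) {F G : ModuleCat.{u} A} (φ : F ⟶ G) :
    X.Diff n E F →ₗ[k] X.Diff n E G :=
  ((LinearMap.compRight k ((forgetA k A).map φ).hom).restrict (by
    rintro _ ⟨L, rfl⟩
    exact ⟨φ.hom ∘ₗ L, rfl⟩))

lemma diffMap_mem_pred (n : ℕ) (E : ModuleCat.{u} A) {F G : ModuleCat.{u} A} (φ : F ⟶ G)
    (Δ : X.Diff n E F) (h : Δ.1 ∈ X.DiffPred E F n) :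
    (X.diffMap n E φ Δ).1 ∈ X.DiffPred E G n := by
  cases n with
  | zero =>
    change ((forgetA k A).map φ).hom ∘ₗ Δ.1 = 0
    rw [show Δ.1 = 0 from h, LinearMap.comp_zero]
  | succ n =>
    obtain ⟨L, hL⟩ := h
    exact ⟨φ.hom ∘ₗ L, by
      change ((forgetA k A).map φ).hom ∘ₗ Δ.1 = _
      rw [hL]; rfl⟩

/-- The functor `Diffⁿ(E, -)` from left `A`-modules to `k`-modules. -/
def diffFunctor (n : ℕ) (E : ModuleCat.{u} A) : ModuleCat.{u} A ⥤ ModuleCat.{u} k where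
  obj F := ModuleCat.of k (X.Diff n E F)
  map φ := ModuleCat.ofHom (X.diffMap n E φ)
  map_id _ := rfl
  map_comp _ _ := rfl

/-- The functor `Symbⁿ(E, -)` from left `A`-modules to `k`-modules. -/
def symbFunctor (n : ℕ) (E : ModuleCat.{u} A) : ModuleCat.{u} A ⥤ ModuleCat.{u} k where
  obj F := ModuleCat.of k (X.Symb n E F)
  map φ := ModuleCat.ofHom (Submodule.mapQ _ _ (X.diffMap n E φ) (X.diffMap_mem_pred n E φ))
  map_id F := by
    apply ModuleCat.hom_ext
    apply LinearMap.ext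
    intro σ
    obtain ⟨Δ, rfl⟩ := Submodule.mkQ_surjective _ σ
    rfl
  map_comp φ ψ := by
    apply ModuleCat.hom_ext
    apply LinearMap.ext
    intro σ
    obtain ⟨Δ, rfl⟩ := Submodule.mkQ_surjective _ σ
    rfl

/-- The symbol map `Diffⁿ(E, -) → Symbⁿ(E, -)`. -/
def symbolMap (n : ℕ) (E : ModuleCat.{u} A) : X.diffFunctor n E ⟶ X.symbFunctor n E where
  app _ := ModuleCat.ofHom (Submodule.mkQ _)
  naturality _ _ _ := rfl

/-- The natural `n`-quantizations for `E`: the natural transformations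
`Symbⁿ(E, -) → Diffⁿ(E, -)` that are sections of the symbol map. -/
def NaturalQuantization (n : ℕ) (E : ModuleCat.{u} A) :=
  {q : X.symbFunctor n E ⟶ X.diffFunctor n E // q ≫ X.symbolMap n E = 𝟙 (X.symbFunctor n E)}

variable {X}

/-- The value on `ιⁿ(SⁿE)` of a lift of an operator of order at most `n` depends only on the class
of the operator modulo operators of order at most `n - 1`, if `ιⁿ(SⁿE) ⊆ A jⁿ(E)`. -/
lemma lift_comp_iota_eq_zero {n : ℕ} {E F : ModuleCat.{u} A}
    (h : LinearMap.range (X.iota n E) ≤ X.elementalJet n E) (L : X.Jet n E →ₗ[A] F)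
    (hL : toK L ∘ₗ X.prolongK n E ∈ X.DiffPred E F n) : L ∘ₗ X.iota n E = 0 := by
  obtain ⟨L', hL'⟩ : ∃ L' : X.JetPred E n →ₗ[A] F,
      ∀ e, L (X.prolong n E e) = L' (X.jetProj E n (X.prolong n E e)) := by
    cases n with
    | zero => exact ⟨0, fun e => LinearMap.congr_fun (show toK L ∘ₗ X.prolongK 0 E = 0 from hL) e⟩
    | succ n =>
      obtain ⟨L', hL'⟩ := hL
      exact ⟨L', fun e => by
        rw [X.jetProj_prolong n E e]; exact LinearMap.congr_fun hL' e⟩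
  have key : Set.EqOn L (L' ∘ₗ X.jetProj E n) (X.elementalJet n E) := by
    refine LinearMap.eqOn_span ?_
    rintro _ ⟨e, rfl⟩
    exact hL' e
  ext s
  have h1 := key (h ⟨s, rfl⟩)
  change L (X.iota n E s) = 0
  rw [h1]
  change L' (X.jetProj E n (X.iota n E s)) = 0
  rw [jetProj_iota, map_zero]

lemma lift_comp_iota_eq {n : ℕ} {E F : ModuleCat.{u} A}
    (h : LinearMap.range (X.iota n E) ≤ X.elementalJet n E) {L L' : X.Jet n E →ₗ[A] F}
    (hL : toK L ∘ₗ X.prolongK n E = toK L' ∘ₗ X.prolongK n E) :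
    L ∘ₗ X.iota n E = L' ∘ₗ X.iota n E := by
  have h0 := lift_comp_iota_eq_zero h (L - L') (by
    have : toK (L - L') ∘ₗ X.prolongK n E
        = toK L ∘ₗ X.prolongK n E - toK L' ∘ₗ X.prolongK n E := rfl
    rw [this, hL, sub_self]; exact zero_mem _)
  rwa [LinearMap.sub_comp, sub_eq_zero] at h0

/-- The map sending an operator `Δ` of order at most `n` to `L ∘ ιⁿ : SⁿE → F`, for any lift `L`
of `Δ`; it is well defined if `ιⁿ(SⁿE) ⊆ A jⁿ(E)`. -/
def restrictLift {n : ℕ} {E : ModuleCat.{u} A}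
    (h : LinearMap.range (X.iota n E) ≤ X.elementalJet n E) (F : ModuleCat.{u} A) :
    X.Diff n E F →+ (X.Sym n E →ₗ[A] F) :=
  AddMonoidHom.mk' (fun Δ => Δ.2.choose ∘ₗ X.iota n E) (fun Δ Δ' =>
    lift_comp_iota_eq h (L' := Δ.2.choose + Δ'.2.choose)
      ((Δ + Δ').2.choose_spec.symm.trans
        (congrArg₂ (· + ·) Δ.2.choose_spec Δ'.2.choose_spec)))

lemma restrictLift_eq {n : ℕ} {E : ModuleCat.{u} A}
    (h : LinearMap.range (X.iota n E) ≤ X.elementalJet n E) (F : ModuleCat.{u} A)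
    (Δ : X.Diff n E F) (L : X.Jet n E →ₗ[A] F) (hL : Δ.1 = toK L ∘ₗ X.prolongK n E) :
    restrictLift h F Δ = L ∘ₗ X.iota n E :=
  lift_comp_iota_eq h (Δ.2.choose_spec.symm.trans hL)

/-- The restriction symbol `rⁿ : Symbⁿ(E, F) → Hom_A(SⁿE, F)`, sending the class of `Δ` to
`L ∘ ιⁿ` for any lift `L` of `Δ`; it is well defined if `ιⁿ(SⁿE) ⊆ A jⁿ(E)`. -/
def restrictionSymbol {n : ℕ} {E : ModuleCat.{u} A}
    (h : LinearMap.range (X.iota n E) ≤ X.elementalJet n E) (F : ModuleCat.{u} A) :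
    X.Symb n E F →+ (X.Sym n E →ₗ[A] F) :=
  QuotientAddGroup.lift _ (restrictLift h F) (fun Δ hΔ =>
    lift_comp_iota_eq_zero h _ (by rw [← Δ.2.choose_spec]; exact hΔ))

/-- The operator `∇ⁿ = λ ∘ jⁿ : E → SⁿE`, where `λ` is the left splitting associated to the
`n`-connection `C`. -/
def nabla {n : ℕ} {E : ModuleCat.{u} A} (h : X.JetSequenceSplitExact n E)
    (C : X.Connection n E) : (forgetA k A).obj E →ₗ[k] (forgetA k A).obj (X.Sym n E) :=
  toK (leftSplitting h C) ∘ₗ X.prolongK n E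

end Operators

end
end ExteriorCalculus

/-! This is the Yoneda lemma, with `SⁿE` representing the symbol functor and an operator `∇ⁿ` giving
the universal symbol. Splitting `0 → SⁿE → JⁿE → Jⁿ⁻¹E → 0` on the right by a connection is the same
as giving a retraction `P` of `ιⁿ` (`leftSplitting_injective`, `exists_leftSplitting_eq`), and `P`
is the same datum as the operator `P ∘ jⁿ : E → SⁿE`, since a map on `JⁿE` is determined by its
values on prolongations (`lift_unique`).

Fix one connection, with operator `∇`. If `L` lifts `Δ`, then `L ∘ ιⁿ ∘ λ - L = -L ∘ C ∘ π` factors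
through the jet projection, so `Δ` and `rⁿ[Δ] ∘ ∇` differ by an operator of lower order
(`mk_quantize`). Hence every symbol `σ` is the image under `rⁿ(σ)` of the symbol of `∇`, whose own
restriction is the identity (`restrictionSymbol_nablaDiff`). A natural transformation `q` out of
`Symbⁿ(E, -)` is therefore determined by the single operator `q[∇] : E → SⁿE`. If `q` is a section
of the symbol map, a lift of this operator restricts to the identity along `ιⁿ`, so it is the left
splitting of a connection, and naturality recovers the formula for `q`. -/

namespace ExteriorCalculus

section Quantization

variable {k : Type w} [CommRing k] {A : Type v} [Ring A] [Algebra k A]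
variable {X : ExteriorCalculus.{w, v, u} k A} {n : ℕ} {E : ModuleCat.{u} A}

/-! ### Lifts of operators and the restriction symbol. -/

/-- Lifts are unique if every jet is elemental. -/
lemma lift_unique (hel : X.elementalJet n E = ⊤) {F : ModuleCat.{u} A} {L L' : X.Jet n E →ₗ[A] F}
    (h : toK L ∘ₗ X.prolongK n E = toK L' ∘ₗ X.prolongK n E) : L = L' := by
  refine LinearMap.ext_on (s := Set.range (X.prolong n E)) hel ?_
  rintro _ ⟨e, rfl⟩
  exact LinearMap.congr_fun h e

/-- An operator with a lift that factors through the jet projection has lower order. -/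
lemma comp_jetProj_mem_diffPred {F : ModuleCat.{u} A} (L : X.JetPred E n →ₗ[A] F) :
    toK (L ∘ₗ X.jetProj E n) ∘ₗ X.prolongK n E ∈ X.DiffPred E F n := by
  cases n with
  | zero =>
    -- In order zero the operators of lower order form the zero submodule and the projection
    -- vanishes, so what remains is that `L` kills `0`.
    change _ = _
    ext e
    exact map_zero L
  | succ n =>
    refine ⟨L, ?_⟩
    ext e
    exact congrArg L (X.jetProj_prolong n E e)

/-- Allows computing with any convenient lift instead of the one picked by choice in `restrictLift`.
-/
lemma restrictionSymbol_mk (h : LinearMap.range (X.iota n E) ≤ X.elementalJet n E)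
    (F : ModuleCat.{u} A) (Δ : X.Diff n E F) (L : X.Jet n E →ₗ[A] F)
    (hL : Δ.1 = toK L ∘ₗ X.prolongK n E) :
    restrictionSymbol h F (Submodule.Quotient.mk Δ) = L ∘ₗ X.iota n E :=
  restrictLift_eq h F Δ L hL

/-- Supplies the scalar half of the `k`-linearity of `quantize`, since `restrictionSymbol` is only
bundled as an additive map. The statement is pointwise because `k` acts on `F` only through `A`. -/
lemma restrictionSymbol_smul (h : LinearMap.range (X.iota n E) ≤ X.elementalJet n E)
    (F : ModuleCat.{u} A) (c : k) (σ : X.Symb n E F) (s : X.Sym n E) :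
    restrictionSymbol h F (c • σ) s = algebraMap k A c • restrictionSymbol h F σ s := by
  obtain ⟨Δ, rfl⟩ := Submodule.mkQ_surjective _ σ
  obtain ⟨Δ, L, rfl⟩ := Δ
  -- A lift of `c • Δ`. Multiplication by an element of `A` need not be `A`-linear, but the image of
  -- `k` is central.
  let cL : X.Jet n E →ₗ[A] F :=
    { toFun := fun x => algebraMap k A c • L x
      map_add' := fun x y => by rw [map_add, smul_add]
      map_smul' := fun a x => by
        rw [map_smul, RingHom.id_apply, smul_smul, smul_smul, Algebra.commutes] }
  have h1 := restrictionSymbol_mk h F (c • ⟨_, L, rfl⟩) cL rfl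
  have h2 := restrictionSymbol_mk h F ⟨_, L, rfl⟩ L rfl
  exact (LinearMap.congr_fun h1 s).trans
    (congrArg (algebraMap k A c • ·) (LinearMap.congr_fun h2 s).symm)

/-- If `L` lifts `Δ`, then `φ ∘ L` lifts `φ ∘ Δ`. This makes `quantize` natural in the target
module. -/
lemma restrictionSymbol_natural (h : LinearMap.range (X.iota n E) ≤ X.elementalJet n E)
    {F G : ModuleCat.{u} A} (φ : F ⟶ G) (σ : X.Symb n E F) :
    restrictionSymbol h G (((X.symbFunctor n E).map φ).hom σ)
      = φ.hom ∘ₗ restrictionSymbol h F σ := by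
  obtain ⟨Δ, rfl⟩ := Submodule.mkQ_surjective _ σ
  obtain ⟨Δ, L, rfl⟩ := Δ
  have h1 := restrictionSymbol_mk h G (X.diffMap n E φ ⟨_, L, rfl⟩) (φ.hom ∘ₗ L) rfl
  have h2 := restrictionSymbol_mk h F ⟨_, L, rfl⟩ L rfl
  exact h1.trans (congrArg (φ.hom ∘ₗ ·) h2.symm)

/-! ### The quantization defined by a connection. -/

/-- The operator `∇ⁿ` as an element of `Diffⁿ(E, SⁿE)`. -/
noncomputable def nablaDiff (hs : X.JetSequenceSplitExact n E) (C : X.Connection n E) :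
    X.Diff n E (X.Sym n E) :=
  ⟨nabla hs C, leftSplitting hs C, rfl⟩

/-- The symbol of `∇ⁿ` restricts to the identity of `SⁿE`. -/
lemma restrictionSymbol_nablaDiff (h : LinearMap.range (X.iota n E) ≤ X.elementalJet n E)
    (hs : X.JetSequenceSplitExact n E) (C : X.Connection n E) :
    restrictionSymbol h (X.Sym n E) (Submodule.Quotient.mk (nablaDiff hs C)) = LinearMap.id :=
  (restrictionSymbol_mk h _ _ (leftSplitting hs C) rfl).trans (leftSplitting_comp_iota X hs C)

/-- The operator `rⁿ(σ) ∘ ∇ⁿ`. -/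
noncomputable def quantize (h : LinearMap.range (X.iota n E) ≤ X.elementalJet n E)
    (hs : X.JetSequenceSplitExact n E) (C : X.Connection n E) (F : ModuleCat.{u} A) :
    X.Symb n E F →ₗ[k] X.Diff n E F where
  toFun σ := X.diffMap n E (ModuleCat.ofHom (restrictionSymbol h F σ)) (nablaDiff hs C)
  map_add' σ τ := Subtype.ext <| LinearMap.ext fun e =>
    LinearMap.congr_fun (map_add (restrictionSymbol h F) σ τ) (nabla hs C e)
  map_smul' c σ := Subtype.ext <| LinearMap.ext fun e =>
    restrictionSymbol_smul h F c σ (nabla hs C e)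

/-- The symbol of `rⁿ(σ) ∘ ∇ⁿ` is `σ`. -/
lemma mk_quantize (h : LinearMap.range (X.iota n E) ≤ X.elementalJet n E)
    (hs : X.JetSequenceSplitExact n E) (C : X.Connection n E) (F : ModuleCat.{u} A)
    (σ : X.Symb n E F) : (Submodule.Quotient.mk (quantize h hs C F σ) : X.Symb n E F) = σ := by
  obtain ⟨Δ, rfl⟩ := Submodule.mkQ_surjective _ σ
  obtain ⟨Δ, L, rfl⟩ := Δ
  refine (Submodule.Quotient.eq _).2 ?_
  -- On jets, `ιⁿ ∘ λ = id - C ∘ π`. Applying `L` leaves the error term `-L ∘ C ∘ π`, which has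
  -- lower order because it factors through `π`.
  have key : (X.Diff n E F).subtype ((quantize h hs C F (Submodule.mkQ _ ⟨_, L, rfl⟩)) - ⟨_, L, rfl⟩)
      = toK ((-(L ∘ₗ C.1)) ∘ₗ X.jetProj E n) ∘ₗ X.prolongK n E := by
    ext e
    change restrictionSymbol h F (Submodule.Quotient.mk ⟨_, L, rfl⟩)
        (leftSplitting hs C (X.prolong n E e)) - L (X.prolong n E e)
      = -L (C.1 (X.jetProj E n (X.prolong n E e)))
    rw [restrictionSymbol_mk h F ⟨_, L, rfl⟩ L rfl]
    change L (X.iota n E (leftSplitting hs C (X.prolong n E e))) - _ = _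
    rw [iota_leftSplitting, map_sub]
    abel
  change _ ∈ X.DiffPred E F n
  exact key ▸ comp_jetProj_mem_diffPred _

/-- The natural quantization `σ ↦ rⁿ(σ) ∘ ∇ⁿ` associated to an `n`-connection. -/
noncomputable def quantization (h : LinearMap.range (X.iota n E) ≤ X.elementalJet n E)
    (hs : X.JetSequenceSplitExact n E) (C : X.Connection n E) : X.NaturalQuantization n E :=
  ⟨{ app := fun F => ModuleCat.ofHom (quantize h hs C F)
     naturality := fun F G φ => by
      apply ModuleCat.hom_ext
      apply LinearMap.ext
      intro σ
      exact Subtype.ext <| LinearMap.ext fun e =>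
        LinearMap.congr_fun (restrictionSymbol_natural h φ σ) (nabla hs C e) }, by
    apply NatTrans.ext
    funext F
    apply ModuleCat.hom_ext
    apply LinearMap.ext
    intro σ
    exact mk_quantize h hs C F σ⟩

/-! ### Connections as retractions of `ιⁿ`. -/

/-- Connections with the same left splitting are equal. -/
lemma leftSplitting_injective (hs : X.JetSequenceSplitExact n E) :
    Function.Injective (leftSplitting hs) := by
  intro C C' h
  apply Subtype.ext
  apply LinearMap.ext
  intro y
  obtain ⟨x, rfl⟩ := hs.surjective y
  have h1 := iota_leftSplitting X hs C x
  rw [h, iota_leftSplitting] at h1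
  exact (sub_right_injective h1).symm

/-- Every retraction of `ιⁿ` is the left splitting associated to a connection. -/
lemma exists_leftSplitting_eq (hs : X.JetSequenceSplitExact n E) (P : X.Jet n E →ₗ[A] X.Sym n E)
    (hP : P ∘ₗ X.iota n E = LinearMap.id) : ∃ C, leftSplitting hs C = P := by
  obtain ⟨C₀, hC₀⟩ := hs.split
  have hP' : ∀ s, P (X.iota n E s) = s := LinearMap.congr_fun hP
  -- The given section is pushed into the kernel of `P` by subtracting `ιⁿ ∘ P`; it stays a section
  -- because `π ∘ ιⁿ = 0`.
  have hC : X.jetProj E n ∘ₗ (LinearMap.id - X.iota n E ∘ₗ P) ∘ₗ C₀ = LinearMap.id := by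
    ext y
    change X.jetProj E n (C₀ y - X.iota n E (P (C₀ y))) = y
    rw [map_sub, jetProj_iota, sub_zero]
    exact LinearMap.congr_fun hC₀ y
  let C : X.Connection n E := ⟨_, hC⟩
  refine ⟨C, ?_⟩
  ext x
  apply hs.injective
  rw [iota_leftSplitting X hs C]
  change x - (C₀ (X.jetProj E n x) - X.iota n E (P (C₀ (X.jetProj E n x)))) = _
  have h := iota_leftSplitting X hs ⟨C₀, hC₀⟩ x
  change _ = x - C₀ (X.jetProj E n x) at h
  -- `C₀ (π x)` differs from `x` by an element of the image of `ιⁿ`, which `id - ιⁿ ∘ P` kills. So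
  -- the corrected section sends `π x` to `x - ιⁿ (P x)`, whatever `C₀` was.
  have h' : C₀ (X.jetProj E n x) = x - X.iota n E (leftSplitting hs ⟨C₀, hC₀⟩ x) := by
    rw [h]; abel
  rw [h', map_sub, hP', map_sub]
  abel

/-! ### Bijectivity, by evaluation at the universal symbol. -/

/-- Evaluating a quantization at a symbol that restricts to the identity of `SⁿE` returns its
operator `∇ⁿ`. Uniqueness of lifts then recovers the left splitting, and with it the connection. -/
lemma quantization_injective (hel : X.elementalJet n E = ⊤)
    (hs : X.JetSequenceSplitExact n E) :
    Function.Injective (quantization (le_top.trans hel.ge) hs) := by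
  intro C C' hCC
  have h : LinearMap.range (X.iota n E) ≤ X.elementalJet n E := le_top.trans hel.ge
  apply leftSplitting_injective hs
  apply lift_unique hel
  -- Both quantizations are evaluated at the symbol coming from `C`. Its restriction is the
  -- identity, so the second one returns the operator of `C'`.
  have h1 := congrArg (fun q : X.NaturalQuantization n E =>
    ((q.1.app (X.Sym n E)).hom (Submodule.Quotient.mk (nablaDiff hs C))).1) hCC
  ext e
  have h2 := LinearMap.congr_fun h1 e
  have hr := restrictionSymbol_nablaDiff h hs C
  exact ((LinearMap.congr_fun hr (nabla hs C e)).symm.trans h2).trans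
    (LinearMap.congr_fun hr (nabla hs C' e))

/-- The Yoneda step: the value of `q` at one universal symbol yields the connection, and naturality
then fixes `q` at every symbol. -/
lemma quantization_surjective (hel : X.elementalJet n E = ⊤)
    (hs : X.JetSequenceSplitExact n E) :
    Function.Surjective (quantization (le_top.trans hel.ge) hs) := by
  rintro ⟨q, hq⟩
  have h : LinearMap.range (X.iota n E) ≤ X.elementalJet n E := le_top.trans hel.ge
  obtain ⟨C₀, hC₀⟩ := hs.split
  -- The universal symbol. The auxiliary connection `C₀` only serves to produce it and is in general
  -- not the connection sought.
  let σ₀ : X.Symb n E (X.Sym n E) := Submodule.Quotient.mk (nablaDiff hs ⟨C₀, hC₀⟩)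
  have hσ₀ : restrictionSymbol h _ σ₀ = LinearMap.id := restrictionSymbol_nablaDiff h hs ⟨C₀, hC₀⟩
  let Δ : X.Diff n E (X.Sym n E) := (q.app (X.Sym n E)).hom σ₀
  obtain ⟨P, hPΔ⟩ := Δ.2
  have hΔ : (Submodule.Quotient.mk Δ : X.Symb n E (X.Sym n E)) = σ₀ :=
    LinearMap.congr_fun (congrArg (fun t => (t.app (X.Sym n E)).hom) hq) σ₀
  -- As `q` is a section of the symbol map, `Δ` has symbol `σ₀`. Hence `P ∘ ιⁿ`, the restriction of
  -- that symbol, is the identity.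
  obtain ⟨C, rfl⟩ := exists_leftSplitting_eq hs P (by
    rw [← restrictionSymbol_mk h _ Δ P hPΔ, hΔ, hσ₀])
  refine ⟨C, Subtype.ext <| NatTrans.ext <| funext fun F => ModuleCat.hom_ext <|
    LinearMap.ext fun (σ : X.Symb n E F) => ?_⟩
  let φ : X.Sym n E ⟶ F := ModuleCat.ofHom (restrictionSymbol h F σ)
  -- Universality of `σ₀`: pushing it forward along `rⁿ(σ)` gives the symbol of the
  -- `C₀`-quantization of `σ`, which is `σ` again.
  have hσ : ((X.symbFunctor n E).map φ).hom σ₀ = σ := mk_quantize h hs ⟨C₀, hC₀⟩ F σ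
  have hnat := LinearMap.congr_fun (congrArg ModuleCat.Hom.hom (q.naturality φ)) σ₀
  change (q.app F).hom (((X.symbFunctor n E).map φ).hom σ₀) = X.diffMap n E φ Δ at hnat
  rw [hσ] at hnat
  refine Eq.trans ?_ hnat.symm
  -- Naturality has reduced `q(σ)` to `rⁿ(σ) ∘ Δ`, and `Δ` is the operator of `C` because its lift
  -- `P` is now the left splitting of `C`.
  exact congrArg (X.diffMap n E φ) (Subtype.ext hPΔ.symm : nablaDiff hs C = Δ)

end Quantization

end ExteriorCalculus

theorem theorem5p7 {k : Type w} [CommRing k] {A : Type v} [Ring A] [Algebra k A]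
    (X : ExteriorCalculus.{w, v, u} k A) (n : ℕ) (E : ModuleCat.{u} A)
    (hel : X.elementalJet n E = ⊤) (hsplit : X.JetSequenceSplitExact n E) :
    ∃ Φ : X.Connection n E ≃ X.NaturalQuantization n E,
      ∀ (C : X.Connection n E) (F : ModuleCat.{u} A) (σ : X.Symb n E F),
        (((Φ C).1.app F).hom σ).1 =
          ExteriorCalculus.toK (ExteriorCalculus.restrictionSymbol (le_top.trans hel.ge) F σ) ∘ₗ
            ExteriorCalculus.nabla hsplit C :=
  -- The required formula holds by the definition of `quantize`, so only bijectivity needs proof.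
  ⟨Equiv.ofBijective _ ⟨ExteriorCalculus.quantization_injective hel hsplit,
    ExteriorCalculus.quantization_surjective hel hsplit⟩, fun _ _ _ => rfl⟩
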